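/- Fix a ribbon width $w \in \mathbb{N}$, $w \ge 1$, a number of keys $n \ge 1$ and a number of columns $m \ge w$, and let $\varepsilon = \frac{m-n}{n}$. Let $S$ be a set of $n$ keys from a universe $\mathcal{U}$ and let $y \in \mathcal{U} \setminus S$. Independently for each $x \in \mathcal{U}$, choose a starting position $s(x)$ uniformly at random from $\{1,\dots,m-w+1\}$ and, independently of it, a coefficient vector $c(x)$ uniformly at random from $\{0,1\}^w$, and let $\vec h(x) = 0^{s(x)-1}\, c(x)\, 0^{m-s(x)-w+1} \in \{0,1\}^m$. Let $p$ be the probability that $\vec h(y)$ lies in the span of $(\vec h(x))_{x \in S}$ over the two-element field. There are absolute constants $C > 0$ and $\kappa > 0$, independent of $w$, $n$, $m$ and $\varepsilon$, such that whenever $$C\,\frac{\log w}{w} \le \varepsilon \le \frac12$$ we have $$p \le \exp(-\kappa\, \varepsilon w).$$ -/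

import Mathlib

open MeasureTheory ProbabilityTheory

/-- The two-element field carries the discrete σ-algebra. -/
instance ribbonMeasurableSpaceZMod : MeasurableSpace (ZMod 2) := ⊤

instance ribbonDiscreteZMod : DiscreteMeasurableSpace (ZMod 2) := ⟨fun _ => trivial⟩

/-- The row vector in `{0,1}^m` (over the two-element field) with ribbon width `w`, starting
position `s` and coefficient vector `c`: zeros, then `c` written in the positions
`s, …, s + w - 1`, then zeros. Positions are counted from `0`, so the `m - w + 1` admissible
starting positions are `0, …, m - w`. -/
def ribbonRow (m w : ℕ) (s : Fin (m - w + 1)) (c : Fin w → ZMod 2) : Fin m → ZMod 2 :=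
  fun i => if h : s.val ≤ i.val ∧ i.val < s.val + w then c ⟨i.val - s.val, by omega⟩ else 0

/-- `s` and `c` form a fully random ribbon hash function on the universe `U`: over the keys
`x : U` the pairs `(s x, c x)` are independent, and each pair is uniformly distributed on
`Fin (m - w + 1) × {0,1}^w`, that is, `s x` is a uniform starting position and `c x` is an
independent uniform coefficient vector. -/
structure IsRandomRibbonHash {U Ω : Type*} [MeasurableSpace Ω] (P : Measure Ω) (m w : ℕ)
    (s : U → Ω → Fin (m - w + 1)) (c : U → Ω → (Fin w → ZMod 2)) : Prop where
  measurable : ∀ x, Measurable (fun ω => (s x ω, c x ω))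
  indep : iIndepFun (fun x ω => (s x ω, c x ω)) P
  uniform : ∀ x, P.map (fun ω => (s x ω, c x ω)) = uniformOn Set.univ

/-- The probability that the row vector of `y` lies in the linear span, over the two-element
field, of the row vectors of the keys `x ∈ S`. -/
noncomputable def spanProb {U Ω : Type*} [MeasurableSpace Ω] (P : Measure Ω) (m w : ℕ)
    (s : U → Ω → Fin (m - w + 1)) (c : U → Ω → (Fin w → ZMod 2)) (S : Finset U) (y : U) : ℝ :=
  P.real {ω | ribbonRow m w (s y ω) (c y ω) ∈
    Submodule.span (ZMod 2) ((fun x => ribbonRow m w (s x ω) (c x ω)) '' (S : Set U))}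

/-! Fix the starting positions and let the query start at `i`. The coefficient vectors `d` for which
its row lies in the row space form a space `V`, so the conditional probability is `2 ^ (dim V - w)`,
which is at most `a ^ (dim V - w)` for `1 ≤ a ≤ 2`. A vector of the row space that lives in the
window at `i` splits into what elimination from the left carries to column `i`, the rows starting at
`i`, and what elimination from the right carries back to the window; hence `dim V` is at most the
sum of three dimensions (`finrank_comap_ribbonRowLinear_le`).

Each carried dimension behaves like a queue: column `j` admits the rows starting there, and its
fresh uniform bits remove one dimension unless they vanish on the whole space, which has probability
`2 ^ (-dim)`. Since `a ≤ 2`, such a failure costs only an additive constant in the exponential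
moment (`sum_pow_finrank_inf_ker_le`), and unrolling gives `queueBound`, a sum over windows of `a ^
(arrivals - length)`.

The left and right bounds multiply to a double sum over intervals around `i`
(`queueBound_mul_queueBound`). Averaged over the starting positions, each term is a binomial
exponential moment (`window_moment_le`): the factor `exp (-3 ε w / 32)` comes out, and the rest
decays geometrically in the interval length. Summing costs a power of `1 / ε`, polynomial in `w`,
which `ε ≥ C log w / w` absorbs (`poly_mul_exp_le`). Width one, where `log w = 0`, is handled by a
union bound. -/

set_option linter.unusedSectionVars false

/-! ### Column-by-column elimination as a queue of dimensions. -/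

section Elimination

variable {ι : Type*} [Fintype ι] [DecidableEq ι]

/-- The linear form on coefficient vectors that reads off column `j` of a combination of rows. -/
def columnForm (h : ι → ℕ → ZMod 2) (j : ℕ) : (ι → ZMod 2) →ₗ[ZMod 2] ZMod 2 where
  toFun t := ∑ x, t x * h x j
  map_add' t u := by simp [add_mul, Finset.sum_add_distrib]
  map_smul' a t := by simp [Finset.mul_sum, mul_assoc]

theorem columnForm_apply (h : ι → ℕ → ZMod 2) (j : ℕ) (t : ι → ZMod 2) :
    columnForm h j t = ∑ x, t x * h x j := rfl

/-- The projection of coefficient vectors to the coordinates satisfying `p`. -/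
def coordMask (p : ι → Prop) [DecidablePred p] : (ι → ZMod 2) →ₗ[ZMod 2] (ι → ZMod 2) where
  toFun t x := if p x then t x else 0
  map_add' t u := by ext x; by_cases hx : p x <;> simp [hx]
  map_smul' a t := by ext x; by_cases hx : p x <;> simp [hx]

theorem coordMask_apply (p : ι → Prop) [DecidablePred p] (t : ι → ZMod 2) (x : ι) :
    coordMask p t x = if p x then t x else 0 := rfl

/-- The coefficient vectors supported on the rows that start at column `j`. -/
def startSpace (s : ι → ℕ) (j : ℕ) : Submodule (ZMod 2) (ι → ZMod 2) :=
  Submodule.span (ZMod 2)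
    ((Finset.univ.filter fun x => s x = j).image fun x => (Pi.single x 1 : ι → ZMod 2) : Finset _)

theorem mem_startSpace {s : ι → ℕ} {j : ℕ} {t : ι → ZMod 2} :
    t ∈ startSpace s j ↔ ∀ x, t x ≠ 0 → s x = j := by
  constructor
  · intro ht
    induction ht using Submodule.span_induction with
    | mem v hv =>
      simp only [Finset.coe_image, Finset.coe_filter, Finset.mem_univ, true_and, Set.mem_image,
        Set.mem_ofPred_eq] at hv
      obtain ⟨x, hx, rfl⟩ := hv
      intro z hz
      by_cases hzx : z = x
      · exact hzx ▸ hx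
      · simp [hzx] at hz
    | zero => simp
    | add u v _ _ hu hv =>
      intro x hx
      by_cases hux : u x = 0
      · exact hv x fun hvx => hx (by simp [hux, hvx])
      · exact hu x hux
    | smul a v _ hv =>
      intro x hx
      exact hv x fun hvx => hx (by simp [hvx])
  · intro ht
    rw [← Finset.univ_sum_single t]
    refine Submodule.sum_mem _ fun x _ => ?_
    by_cases hx : t x = 0
    · simp [hx]
    · have : (Pi.single x (t x) : ι → ZMod 2) = t x • Pi.single x 1 := by
        rw [← Pi.single_smul]; simp
      rw [this]
      refine Submodule.smul_mem _ _ (Submodule.subset_span ?_)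
      simp only [Finset.coe_image, Finset.coe_filter, Finset.mem_univ, true_and]
      exact ⟨x, ht x hx, rfl⟩

theorem finrank_startSpace_le (s : ι → ℕ) (j : ℕ) :
    Module.finrank (ZMod 2) (startSpace s j) ≤ (Finset.univ.filter fun x => s x = j).card :=
  (finrank_span_finset_le_card _).trans Finset.card_image_le

/-- The space of coefficient vectors carried over column `j` by elimination from left to right:
the rows starting before column `j` take part, the columns before `j` have been cleared, and the
coefficients of rows that end before column `j` have been forgotten. -/
def elimSpace (w : ℕ) (s : ι → ℕ) (h : ι → ℕ → ZMod 2) :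
    ℕ → Submodule (ZMod 2) (ι → ZMod 2)
  | 0 => ⊥
  | j + 1 => ((elimSpace w s h j ⊔ startSpace s j) ⊓ LinearMap.ker (columnForm h j)).map
      (coordMask fun x => j + 1 < s x + w)

/-- Row `x` of `h` is supported on the `w` columns from `s x` on. -/
def IsRibbon (w : ℕ) (s : ι → ℕ) (h : ι → ℕ → ZMod 2) : Prop :=
  ∀ x j, h x j ≠ 0 → s x ≤ j ∧ j < s x + w

theorem elimSpace_support {w : ℕ} {s : ι → ℕ} {h : ι → ℕ → ZMod 2} :
    ∀ {j : ℕ} {t : ι → ZMod 2}, t ∈ elimSpace w s h j → ∀ x, t x ≠ 0 → s x < j ∧ j < s x + w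
  | 0, t, ht, x, hx => by
    simp only [elimSpace, Submodule.mem_bot] at ht
    simp [ht] at hx
  | j + 1, t, ht, x, hx => by
    obtain ⟨u, ⟨hu, -⟩, rfl⟩ := ht
    obtain ⟨a, ha, b, hb, rfl⟩ := Submodule.mem_sup.1 hu
    rw [coordMask_apply] at hx
    split_ifs at hx with hj
    · refine ⟨?_, hj⟩
      by_cases hax : a x = 0
      · have := mem_startSpace.1 hb x fun hbx => hx (by simp [hax, hbx])
        omega
      · have := (elimSpace_support ha x hax).1
        omega
    · exact absurd rfl hx

/-- This is why finished rows are forgotten: every row still in play has a free random bit in column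
`j`, so the column acts on the carried space as a uniform linear form. -/
theorem elimSpace_sup_startSpace_support {w : ℕ} (hw : 1 ≤ w) {s : ι → ℕ} {h : ι → ℕ → ZMod 2}
    {j : ℕ} {t : ι → ZMod 2} (ht : t ∈ elimSpace w s h j ⊔ startSpace s j) (x : ι) (hx : t x ≠ 0) :
    s x ≤ j ∧ j < s x + w := by
  obtain ⟨a, ha, b, hb, rfl⟩ := Submodule.mem_sup.1 ht
  by_cases hax : a x = 0
  · have := mem_startSpace.1 hb x fun hbx => hx (by simp [hax, hbx])
    omega
  · have := elimSpace_support ha x hax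
    omega

/-- Stands in for independence: the space carried to column `j` is unaffected by rerandomizing
column `j` or any later one. -/
theorem elimSpace_congr {w : ℕ} {s : ι → ℕ} {h h' : ι → ℕ → ZMod 2} :
    ∀ {j : ℕ}, (∀ i < j, ∀ x, h x i = h' x i) → elimSpace w s h j = elimSpace w s h' j
  | 0, _ => rfl
  | j + 1, H => by
    have hc : columnForm h j = columnForm h' j := by
      ext t
      simp [columnForm_apply, H j (Nat.lt_succ_self j)]
    rw [elimSpace, elimSpace, hc, elimSpace_congr fun i hi => H i (hi.trans (Nat.lt_succ_self j))]

theorem finrank_elimSpace_succ_le (w : ℕ) (s : ι → ℕ) (h : ι → ℕ → ZMod 2) (j : ℕ) :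
    Module.finrank (ZMod 2) (elimSpace w s h (j + 1)) ≤
      Module.finrank (ZMod 2) ((elimSpace w s h j ⊔ startSpace s j) ⊓
        LinearMap.ker (columnForm h j) : Submodule (ZMod 2) (ι → ZMod 2)) :=
  Submodule.finrank_map_le _ _

theorem finrank_elimSpace_sup_le (w : ℕ) (s : ι → ℕ) (h : ι → ℕ → ZMod 2) (j : ℕ) :
    Module.finrank (ZMod 2) (elimSpace w s h j ⊔ startSpace s j : Submodule (ZMod 2) (ι → ZMod 2)) ≤
      Module.finrank (ZMod 2) (elimSpace w s h j) + (Finset.univ.filter fun x => s x = j).card :=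
  (Submodule.finrank_add_le_finrank_add_finrank _ _).trans
    (Nat.add_le_add_left (finrank_startSpace_le s j) _)

/-- A combination of rows starting before column `j` that vanishes before column `j` agrees from
column `j` on with a combination taken from the elimination space. -/
theorem exists_mem_elimSpace {w : ℕ} {s : ι → ℕ} {h : ι → ℕ → ZMod 2} (hr : IsRibbon w s h) :
    ∀ {j : ℕ} {t : ι → ZMod 2}, (∀ x, t x ≠ 0 → s x < j) → (∀ i < j, columnForm h i t = 0) →
      ∃ g ∈ elimSpace w s h j, ∀ i, j ≤ i → columnForm h i g = columnForm h i t
  | 0, t, ht, _ => by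
    have : t = 0 := by
      ext x
      by_contra hx
      exact absurd (ht x hx) (Nat.not_lt_zero _)
    exact ⟨0, Submodule.zero_mem _, by simp [this]⟩
  | j + 1, t, ht, hv => by
    set t₀ := coordMask (fun x => s x < j) t with ht₀
    set t₁ := coordMask (fun x => s x = j) t with ht₁
    have hsum : t = t₀ + t₁ := by
      ext x
      simp only [ht₀, ht₁, Pi.add_apply, coordMask_apply]
      by_cases hx : t x = 0
      · simp [hx]
      · have := ht x hx
        rcases Nat.lt_or_ge (s x) j with h1 | h1
        · simp [h1, h1.ne]
        · have : s x = j := by omega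
          simp [this]
    have ht₁s : ∀ x, t₁ x ≠ 0 → s x = j := by
      intro x hx
      by_contra hne
      simp [ht₁, coordMask_apply, hne] at hx
    obtain ⟨g₀, hg₀, hg₀v⟩ := exists_mem_elimSpace hr (j := j) (t := t₀)
      (fun x hx => by
        by_contra hne
        simp [ht₀, coordMask_apply, hne] at hx)
      -- Rows starting at `j` are zero in earlier columns, so `t₀` inherits the vanishing from `t`.
      (fun i hi => by
        have h1 : columnForm h i t₁ = 0 := by
          rw [columnForm_apply]
          refine Finset.sum_eq_zero fun x _ => ?_
          by_contra hne
          have := (hr x i (right_ne_zero_of_mul hne)).1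
          have := ht₁s x (left_ne_zero_of_mul hne)
          omega
        have h2 := hv i (by omega)
        rwa [hsum, map_add, h1, add_zero] at h2)
    refine ⟨coordMask (fun x => j + 1 < s x + w) (g₀ + t₁), ⟨g₀ + t₁, ⟨?_, ?_⟩, rfl⟩, ?_⟩
    · exact Submodule.add_mem_sup hg₀ (mem_startSpace.2 ht₁s)
    · show columnForm h j (g₀ + t₁) = 0
      rw [map_add, hg₀v j le_rfl, ← map_add, ← hsum]
      exact hv j (Nat.lt_succ_self j)
    · intro i hi
      have hgt : columnForm h i t = columnForm h i (g₀ + t₁) := by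
        rw [hsum, map_add, map_add, hg₀v i (by omega)]
      rw [hgt, columnForm_apply, columnForm_apply]
      refine Finset.sum_congr rfl fun x _ => ?_
      rw [coordMask_apply]
      split_ifs with hx
      · rfl
      · have : h x i = 0 := by
          by_contra hne
          have := (hr x i hne).2
          omega
        simp [this]

/-! ### Averaging over the bits of a column -/

open Classical in
/-- A shifted uniform linear form vanishes on `H` with probability `2 ^ (-dim H)`. -/
theorem card_filter_le_ker_mul (H : Submodule (ZMod 2) (ι → ZMod 2)) (b : ι → ZMod 2) :
    (Finset.univ.filter fun v : ι → ZMod 2 =>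
        H ≤ LinearMap.ker (dotProductEquiv (ZMod 2) ι (b + v))).card *
      2 ^ Module.finrank (ZMod 2) H = Fintype.card (ι → ZMod 2) := by
  have h1 : (Finset.univ.filter fun v : ι → ZMod 2 =>
      H ≤ LinearMap.ker (dotProductEquiv (ZMod 2) ι (b + v))).card =
      Nat.card H.dualAnnihilator := by
    rw [← Fintype.card_subtype, ← Nat.card_eq_fintype_card]
    refine Nat.card_congr (((Equiv.addLeft b).trans
      (dotProductEquiv (ZMod 2) ι).toEquiv).subtypeEquiv fun v => ?_)
    rw [Submodule.mem_dualAnnihilator]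
    rfl
  have h2 := Subspace.finrank_add_finrank_dualAnnihilator_eq H
  rw [h1, Module.natCard_eq_pow_finrank (K := ZMod 2), Nat.card_zmod, ← pow_add,
    Module.card_eq_pow_finrank (K := ZMod 2), ZMod.card, ← h2, add_comm]

/-- Cutting a space `H` by a uniform linear form divides `a ^ dim H` by `a` on average, up to an
additive error. -/
theorem sum_pow_finrank_inf_ker_le (H : Submodule (ZMod 2) (ι → ZMod 2)) (b : ι → ZMod 2)
    {a : ℝ} (ha1 : 1 ≤ a) (ha2 : a ≤ 2) :
    a * ∑ v : ι → ZMod 2, a ^ Module.finrank (ZMod 2)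
        (H ⊓ LinearMap.ker (dotProductEquiv (ZMod 2) ι (b + v)) :
          Submodule (ZMod 2) (ι → ZMod 2)) ≤
      Fintype.card (ι → ZMod 2) * (a ^ Module.finrank (ZMod 2) H + (a - 1)) := by
  classical
  set Q := Module.finrank (ZMod 2) H with hQ
  have hpt : ∀ v : ι → ZMod 2, a * a ^ Module.finrank (ZMod 2)
        (H ⊓ LinearMap.ker (dotProductEquiv (ZMod 2) ι (b + v)) :
          Submodule (ZMod 2) (ι → ZMod 2)) ≤ a ^ Q +
        if H ≤ LinearMap.ker (dotProductEquiv (ZMod 2) ι (b + v)) then (a - 1) * a ^ Q else 0 := by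
    intro v
    split_ifs with hv
    · rw [inf_eq_left.2 hv]
      exact le_of_eq (by ring)
    · rw [← pow_succ', add_zero]
      exact pow_le_pow_right₀ ha1 (Submodule.finrank_lt_finrank_of_lt (inf_lt_left.2 hv))
  have hc := card_filter_le_ker_mul H b
  set N := (Finset.univ.filter fun v : ι → ZMod 2 =>
        H ≤ LinearMap.ker (dotProductEquiv (ZMod 2) ι (b + v))).card with hN
  -- The only use of `a ≤ 2`: the failure probability `2 ^ (-Q)` cancels `a ^ Q`.
  have hNa : (N : ℝ) * a ^ Q ≤ Fintype.card (ι → ZMod 2) := by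
    rw [← hc]
    push_cast
    gcongr
  calc _ = ∑ v : ι → ZMod 2, a * a ^ Module.finrank (ZMod 2)
        (H ⊓ LinearMap.ker (dotProductEquiv (ZMod 2) ι (b + v)) :
          Submodule (ZMod 2) (ι → ZMod 2)) := Finset.mul_sum _ _ _
    _ ≤ ∑ v : ι → ZMod 2, (a ^ Q +
        if H ≤ LinearMap.ker (dotProductEquiv (ZMod 2) ι (b + v)) then (a - 1) * a ^ Q else 0) :=
      Finset.sum_le_sum fun v _ => hpt v
    _ = Fintype.card (ι → ZMod 2) * a ^ Q + (a - 1) * (N * a ^ Q) := by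
      rw [Finset.sum_add_distrib, ← Finset.sum_filter, Finset.sum_const, Finset.sum_const,
        Finset.card_univ, ← hN, nsmul_eq_mul, nsmul_eq_mul]
      ring
    _ ≤ _ := by
      rw [mul_add, mul_comm (Fintype.card (ι → ZMod 2) : ℝ) (a - 1)]
      gcongr

/-- An upper bound for the exponential moment of `dim (elimSpace w s h j)` over random bits. -/
noncomputable def queueBound (a : ℝ) (s : ι → ℕ) (j : ℕ) : ℝ :=
  ∑ k ∈ Finset.range (j + 1),
    a ^ (Finset.univ.filter fun x => j - k ≤ s x ∧ s x < j).card * (a⁻¹) ^ k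

theorem queueBound_zero (a : ℝ) (s : ι → ℕ) : queueBound a s 0 = 1 := by
  simp [queueBound]

/-- Extending every window by column `j` multiplies its term by `a ^ (arrivals - 1)`; the new empty
window contributes the `1`, which later pays for the additive error `a⁻¹ * (a - 1)`. -/
theorem queueBound_succ (a : ℝ) (s : ι → ℕ) (j : ℕ) :
    queueBound a s (j + 1) =
      a⁻¹ * a ^ (Finset.univ.filter fun x => s x = j).card * queueBound a s j + 1 := by
  rw [queueBound, Finset.sum_range_succ', queueBound, Finset.mul_sum]
  congr 1
  · refine Finset.sum_congr rfl fun k hk => ?_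
    have hk' : k ≤ j := by simpa [Nat.lt_succ_iff] using hk
    have : (Finset.univ.filter fun x => j + 1 - (k + 1) ≤ s x ∧ s x < j + 1).card =
        (Finset.univ.filter fun x => s x = j).card +
          (Finset.univ.filter fun x => j - k ≤ s x ∧ s x < j).card := by
      rw [← Finset.card_union_of_disjoint]
      · congr 1
        ext x
        simp only [Finset.mem_filter, Finset.mem_univ, true_and, Finset.mem_union]
        omega
      · rw [Finset.disjoint_filter]
        intro x _ h1 h2
        omega
    rw [this, pow_add, pow_succ]
    ring
  · have : (Finset.univ.filter fun x => j + 1 - 0 ≤ s x ∧ s x < j + 1) = ∅ := by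
      ext x
      simp only [Finset.mem_filter, Finset.mem_univ, true_and, Finset.notMem_empty, iff_false]
      omega
    rw [this]
    simp

theorem queueBound_nonneg {a : ℝ} (ha : 0 ≤ a) (s : ι → ℕ) (j : ℕ) : 0 ≤ queueBound a s j :=
  Finset.sum_nonneg fun _ _ => by positivity

/-- Exponential moment of the elimination space, for rows `h ω` whose bits are uniform and
independent: every modification of the bits of a column is realized by a translation of `Ω` that
does not affect the weight `g`. -/
theorem sum_pow_finrank_elimSpace_mul_le {Ω : Type*} [Fintype Ω] [AddGroup Ω] {w : ℕ} (hw : 1 ≤ w)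
    {s : ι → ℕ} {h : Ω → ι → ℕ → ZMod 2} {g : Ω → ℝ} (hg : ∀ ω, 0 ≤ g ω) {J : ℕ}
    (hτ : ∀ j < J, ∀ v : ι → ZMod 2, ∃ τ : Ω, (∀ ω, g (ω + τ) = g ω) ∧
      ∀ ω x i, h (ω + τ) x i = h ω x i + if i = j ∧ s x ≤ j ∧ j < s x + w then v x else 0)
    {a : ℝ} (ha1 : 1 ≤ a) (ha2 : a ≤ 2) :
    ∀ j ≤ J, ∑ ω, a ^ Module.finrank (ZMod 2) (elimSpace w s (h ω) j) * g ω ≤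
      queueBound a s j * ∑ ω, g ω
  | 0, _ => by
    have h0 : ∀ ω, Module.finrank (ZMod 2) (elimSpace w s (h ω) 0) = 0 := fun ω =>
      finrank_bot _ _
    simp [queueBound_zero, h0]
  | j + 1, hj => by
    have ih := sum_pow_finrank_elimSpace_mul_le hw hg hτ ha1 ha2 j (by omega)
    have ha0 : 0 < a := by linarith
    choose τ hτg hτh using hτ j (by omega)
    set X := (Finset.univ.filter fun x => s x = j).card with hX
    set H : Ω → Submodule (ZMod 2) (ι → ZMod 2) := fun ω =>
      elimSpace w s (h ω) j ⊔ startSpace s j with hH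
    set f : Ω → ℝ := fun ω => a ^ Module.finrank (ZMod 2)
      (H ω ⊓ LinearMap.ker (columnForm (h ω) j) : Submodule (ZMod 2) (ι → ZMod 2)) * g ω with hf
    have hfτ : ∀ ω v, f (ω + τ v) = a ^ Module.finrank (ZMod 2)
        (H ω ⊓ LinearMap.ker (dotProductEquiv (ZMod 2) ι ((fun x => h ω x j) + v)) :
          Submodule (ZMod 2) (ι → ZMod 2)) * g ω := by
      intro ω v
      have h1 : H (ω + τ v) = H ω := by
        simp only [hH]
        rw [elimSpace_congr (h := h (ω + τ v)) (h' := h ω)]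
        intro i hi x
        rw [hτh, if_neg (by omega), add_zero]
      -- The shift changes only bits inside ribbons, but vectors of `H ω` are supported on rows
      -- covering column `j`, so on `H ω` the form is shifted by all of `v`.
      have h2 : H ω ⊓ LinearMap.ker (columnForm (h (ω + τ v)) j) = H ω ⊓
          LinearMap.ker (dotProductEquiv (ZMod 2) ι ((fun x => h ω x j) + v)) := by
        ext t
        simp only [Submodule.mem_inf, LinearMap.mem_ker]
        refine and_congr_right fun ht => ?_
        have : columnForm (h (ω + τ v)) j t =
            dotProductEquiv (ZMod 2) ι ((fun x => h ω x j) + v) t := by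
          simp only [columnForm_apply, dotProductEquiv_apply_apply, dotProduct, Pi.add_apply]
          refine Finset.sum_congr rfl fun x _ => ?_
          by_cases hx : t x = 0
          · simp [hx]
          · rw [hτh, if_pos ⟨rfl, elimSpace_sup_startSpace_support hw ht x hx⟩, mul_comm]
        rw [this]
      simp only [hf]
      rw [hτg, h1, h2]
    -- Translations permute `Ω`, so averaging over `v` as well does not change the sum.
    have havg : Fintype.card (ι → ZMod 2) * ∑ ω, f ω = ∑ ω, ∑ v, f (ω + τ v) := by
      rw [Finset.sum_comm]
      have : ∀ v, ∑ ω, f (ω + τ v) = ∑ ω, f ω := fun v =>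
        Fintype.sum_equiv (Equiv.addRight (τ v)) _ _ fun _ => rfl
      simp [this]
    have hcard : (0 : ℝ) < Fintype.card (ι → ZMod 2) := by exact_mod_cast Fintype.card_pos
    have hsum : a * ∑ ω, f ω ≤
        ∑ ω, (a ^ Module.finrank (ZMod 2) (H ω) + (a - 1)) * g ω := by
      refine le_of_mul_le_mul_left ?_ hcard
      calc Fintype.card (ι → ZMod 2) * (a * ∑ ω, f ω) = ∑ ω, (a * ∑ v, a ^ Module.finrank (ZMod 2)
        (H ω ⊓ LinearMap.ker (dotProductEquiv (ZMod 2) ι ((fun x => h ω x j) + v)) :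
          Submodule (ZMod 2) (ι → ZMod 2))) * g ω := by
            rw [mul_left_comm, havg, Finset.mul_sum]
            refine Finset.sum_congr rfl fun ω _ => ?_
            simp only [hfτ]
            rw [← Finset.sum_mul, mul_assoc]
        _ ≤ ∑ ω, (Fintype.card (ι → ZMod 2) *
              (a ^ Module.finrank (ZMod 2) (H ω) + (a - 1))) * g ω :=
            Finset.sum_le_sum fun ω _ => mul_le_mul_of_nonneg_right
              (sum_pow_finrank_inf_ker_le (H ω) _ ha1 ha2) (hg ω)
        _ = _ := by
            rw [Finset.mul_sum]
            exact Finset.sum_congr rfl fun ω _ => mul_assoc _ _ _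
    have hsum2 : ∑ ω, (a ^ Module.finrank (ZMod 2) (H ω) + (a - 1)) * g ω ≤
        a ^ X * ∑ ω, a ^ Module.finrank (ZMod 2) (elimSpace w s (h ω) j) * g ω +
          (a - 1) * ∑ ω, g ω := by
      rw [Finset.mul_sum, Finset.mul_sum, ← Finset.sum_add_distrib]
      refine Finset.sum_le_sum fun ω _ => ?_
      rw [add_mul, ← mul_assoc, ← pow_add]
      have := hg ω
      gcongr
      rw [add_comm]
      exact finrank_elimSpace_sup_le w s (h ω) j
    have hG : 0 ≤ ∑ ω, g ω := Finset.sum_nonneg fun ω _ => hg ω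
    calc ∑ ω, a ^ Module.finrank (ZMod 2) (elimSpace w s (h ω) (j + 1)) * g ω ≤ ∑ ω, f ω := by
          refine Finset.sum_le_sum fun ω _ => mul_le_mul_of_nonneg_right ?_ (hg ω)
          exact pow_le_pow_right₀ ha1 (finrank_elimSpace_succ_le w s (h ω) j)
      _ = a⁻¹ * (a * ∑ ω, f ω) := by field_simp
      _ ≤ a⁻¹ * (a ^ X * (queueBound a s j * ∑ ω, g ω) + (a - 1) * ∑ ω, g ω) := by
          gcongr
          refine hsum.trans (hsum2.trans ?_)
          gcongr
      _ ≤ queueBound a s (j + 1) * ∑ ω, g ω := by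
          rw [queueBound_succ, ← hX]
          have : a⁻¹ * (a - 1) ≤ 1 := by
            rw [mul_sub, inv_mul_cancel₀ ha0.ne']
            have := inv_pos.2 ha0
            linarith
          have := mul_le_mul_of_nonneg_right this hG
          linarith

end Elimination

/-! ### The row space seen through the window of the query. -/

section Window

variable {ι : Type*} [Fintype ι] [DecidableEq ι] {m w : ℕ}

/-- The entries of the rows with starting positions `s` and coefficient vectors `c`. -/
def ribbonBits (m w : ℕ) (s : ι → Fin (m - w + 1)) (c : ι → Fin w → ZMod 2) : ι → ℕ → ZMod 2 :=
  fun x j => if hj : j < m then ribbonRow m w (s x) (c x) ⟨j, hj⟩ else 0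

/-- Rows of length `m` read from right to left. -/
def mirrorBits (m : ℕ) (h : ι → ℕ → ZMod 2) : ι → ℕ → ZMod 2 :=
  fun x j => if j < m then h x (m - 1 - j) else 0

theorem ribbonBits_eq (hwm : w ≤ m) (s : ι → Fin (m - w + 1)) (c : ι → Fin w → ZMod 2) (x : ι)
    (j : ℕ) : ribbonBits m w s c x j =
      if h : (s x).val ≤ j ∧ j < (s x).val + w then c x ⟨j - (s x).val, by omega⟩ else 0 := by
  have := (s x).isLt
  unfold ribbonBits ribbonRow
  split_ifs with h1 h2 h2
  · rfl
  · rfl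
  · omega
  · rfl

theorem isRibbon_ribbonBits (hwm : w ≤ m) (s : ι → Fin (m - w + 1)) (c : ι → Fin w → ZMod 2) :
    IsRibbon w (fun x => (s x).val) (ribbonBits m w s c) := by
  intro x j hj
  rw [ribbonBits_eq hwm] at hj
  by_contra hne
  exact hj (dif_neg hne)

theorem isRibbon_mirrorBits (hwm : w ≤ m) (s : ι → Fin (m - w + 1)) (c : ι → Fin w → ZMod 2) :
    IsRibbon w (fun x => m - w - (s x).val) (mirrorBits m (ribbonBits m w s c)) := by
  intro x j hj
  unfold mirrorBits at hj
  split_ifs at hj with hjm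
  · have := isRibbon_ribbonBits hwm s c x _ hj
    have := (s x).isLt
    dsimp only at *
    omega
  · exact absurd rfl hj

/-- The translation of coefficient vectors that adds `v x` to the entry of row `x` in column
`j`. -/
def columnShift (s : ι → Fin (m - w + 1)) (j : ℕ) (v : ι → ZMod 2) : ι → Fin w → ZMod 2 :=
  fun x k => if (s x).val + k.val = j then v x else 0

theorem ribbonBits_add_columnShift (hwm : w ≤ m) (s : ι → Fin (m - w + 1)) (j : ℕ)
    (v : ι → ZMod 2) (c : ι → Fin w → ZMod 2) (x : ι) (i : ℕ) :
    ribbonBits m w s (c + columnShift s j v) x i = ribbonBits m w s c x i +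
      if i = j ∧ (s x).val ≤ j ∧ j < (s x).val + w then v x else 0 := by
  rw [ribbonBits_eq hwm, ribbonBits_eq hwm]
  split_ifs with h1 h2 h2
  · simp only [Pi.add_apply, columnShift]
    rw [if_pos (by omega)]
  · simp only [Pi.add_apply, columnShift]
    rw [if_neg (by omega)]
  · omega
  · simp

theorem mirrorBits_add_columnShift (hwm : w ≤ m) (s : ι → Fin (m - w + 1)) {j : ℕ} (hj : j < m)
    (v : ι → ZMod 2) (c : ι → Fin w → ZMod 2) (x : ι) (i : ℕ) :
    mirrorBits m (ribbonBits m w s (c + columnShift s (m - 1 - j) v)) x i =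
      mirrorBits m (ribbonBits m w s c) x i +
      if i = j ∧ m - w - (s x).val ≤ j ∧ j < m - w - (s x).val + w then v x else 0 := by
  have := (s x).isLt
  unfold mirrorBits
  split_ifs with h1 h2 h2
  · rw [ribbonBits_add_columnShift hwm, if_pos (by omega)]
  · rw [ribbonBits_add_columnShift hwm, if_neg (by omega)]
  · omega
  · simp

/-- Given the starting positions, the exponential moment of the two elimination spaces that meet
at position `i`, one coming from the left and one from the right. -/
theorem sum_pow_finrank_elimSpace_add_le (hw : 1 ≤ w) (hwm : w ≤ m) (s : ι → Fin (m - w + 1))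
    (i : ℕ) {a : ℝ} (ha1 : 1 ≤ a) (ha2 : a ≤ 2) :
    ∑ c : ι → Fin w → ZMod 2,
      a ^ (Module.finrank (ZMod 2) (elimSpace w (fun x => (s x).val) (ribbonBits m w s c) i) +
        Module.finrank (ZMod 2) (elimSpace w (fun x => m - w - (s x).val)
          (mirrorBits m (ribbonBits m w s c)) (m - w - i))) ≤
      Fintype.card (ι → Fin w → ZMod 2) * (queueBound a (fun x => (s x).val) i *
        queueBound a (fun x => m - w - (s x).val) (m - w - i)) := by
  have ha0 : 0 ≤ a := by linarith
  have hB := sum_pow_finrank_elimSpace_mul_le (Ω := ι → Fin w → ZMod 2) hw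
    (s := fun x => m - w - (s x).val) (h := fun c => mirrorBits m (ribbonBits m w s c))
    (g := fun _ => 1) (fun _ => zero_le_one) (J := m - w - i)
    (fun j hj v => ⟨columnShift s (m - 1 - j) v, fun _ => rfl, fun c x i =>
      mirrorBits_add_columnShift hwm s (by omega) v c x i⟩) ha1 ha2 _ le_rfl
  -- The right-hand moment serves as the weight `g`: it depends only on columns from `i + w` on, so
  -- shifts in columns before `i` preserve it, and the two sides decouple.
  have hA := sum_pow_finrank_elimSpace_mul_le (Ω := ι → Fin w → ZMod 2) hw
    (s := fun x => (s x).val) (h := fun c => ribbonBits m w s c)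
    (g := fun c => a ^ Module.finrank (ZMod 2) (elimSpace w (fun x => m - w - (s x).val)
          (mirrorBits m (ribbonBits m w s c)) (m - w - i)))
    (fun _ => by positivity) (J := i)
    (fun j hj v => ⟨columnShift s j v, fun c => by
        rw [elimSpace_congr (h := mirrorBits m (ribbonBits m w s (c + columnShift s j v)))
          (h' := mirrorBits m (ribbonBits m w s c))]
        intro k hk x
        unfold mirrorBits
        have hkm : k < m := by omega
        rw [if_pos hkm, if_pos hkm, ribbonBits_add_columnShift hwm, if_neg (by omega), add_zero],
      fun c x i => ribbonBits_add_columnShift hwm s j v c x i⟩) ha1 ha2 _ le_rfl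
  simp only [mul_one, Finset.sum_const, Finset.card_univ, nsmul_eq_mul] at hB
  simp only [pow_add]
  refine hA.trans ?_
  have := mul_le_mul_of_nonneg_left hB (queueBound_nonneg ha0 (fun x => (s x).val) i)
  refine this.trans (le_of_eq ?_)
  ring

/-- The row with starting position `i`, as a linear function of its coefficient vector. -/
def ribbonRowLinear (m w : ℕ) (i : Fin (m - w + 1)) :
    (Fin w → ZMod 2) →ₗ[ZMod 2] (Fin m → ZMod 2) where
  toFun := ribbonRow m w i
  map_add' c d := by ext j; by_cases hj : i.val ≤ j.val ∧ j.val < i.val + w <;> simp [ribbonRow, hj]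
  map_smul' a c := by ext j; by_cases hj : i.val ≤ j.val ∧ j.val < i.val + w <;> simp [ribbonRow, hj]

/-- The combination of rows, read in the window of `w` columns from `i` on. -/
def windowForm (h : ι → ℕ → ZMod 2) (w i : ℕ) : (ι → ZMod 2) →ₗ[ZMod 2] (Fin w → ZMod 2) :=
  LinearMap.pi fun k => columnForm h (i + k)

/-- The vectors in the row space that are supported in the window at `i` are accounted for by the
elimination spaces from the left and from the right and the rows starting at `i`. -/
theorem finrank_comap_ribbonRowLinear_le (hwm : w ≤ m) (s : ι → Fin (m - w + 1))
    (c : ι → Fin w → ZMod 2) (i : Fin (m - w + 1)) :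
    Module.finrank (ZMod 2) ((Submodule.span (ZMod 2)
        (Set.range fun x => ribbonRow m w (s x) (c x))).comap (ribbonRowLinear m w i)) ≤
      Module.finrank (ZMod 2) (elimSpace w (fun x => (s x).val) (ribbonBits m w s c) i) +
      (Finset.univ.filter fun x => (s x).val = i.val).card +
      Module.finrank (ZMod 2) (elimSpace w (fun x => m - w - (s x).val)
          (mirrorBits m (ribbonBits m w s c)) (m - w - i)) := by
  set h := ribbonBits m w s c with hh
  set A := elimSpace w (fun x => (s x).val) h i
  set B := elimSpace w (fun x => m - w - (s x).val) (mirrorBits m h) (m - w - i)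
  have hr := isRibbon_ribbonBits hwm s c
  have hr' := isRibbon_mirrorBits hwm s c
  rw [← hh] at hr hr'
  have hilt := i.isLt
  have hmir : ∀ j < m, ∀ t, columnForm (mirrorBits m h) j t = columnForm h (m - 1 - j) t := by
    intro j hj t
    simp [columnForm_apply, mirrorBits, hj]
  have key : (Submodule.span (ZMod 2)
        (Set.range fun x => ribbonRow m w (s x) (c x))).comap (ribbonRowLinear m w i) ≤
      (A ⊔ startSpace (fun x => (s x).val) i ⊔ B).map (windowForm h w i) := by
    intro d hd
    obtain ⟨t, ht⟩ := (Submodule.mem_span_range_iff_exists_fun (ZMod 2)).1 (Submodule.mem_comap.1 hd)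
    have htc : ∀ j (hj : j < m), columnForm h j t = ribbonRow m w i d ⟨j, hj⟩ := by
      intro j hj
      have := congrFun ht ⟨j, hj⟩
      rw [Finset.sum_apply] at this
      rw [columnForm_apply]
      refine Eq.trans (Finset.sum_congr rfl fun x _ => ?_) this
      simp [hh, ribbonBits, hj]
    set t₀ := coordMask (fun x => (s x).val < i) t with ht₀
    set t₁ := coordMask (fun x => (s x).val = i) t with ht₁
    set t₂ := coordMask (fun x => (s x).val > i) t with ht₂
    have hsum : t = t₀ + t₁ + t₂ := by
      ext x
      simp only [ht₀, ht₁, ht₂, Pi.add_apply, coordMask_apply]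
      rcases lt_trichotomy (s x).val i.val with h1 | h1 | h1
      · rw [if_pos h1, if_neg h1.ne, if_neg (by omega)]; simp
      · rw [if_neg (by omega), if_pos h1, if_neg (by omega)]; simp
      · rw [if_neg (by omega), if_neg (by omega), if_pos h1]; simp
    have hs₀ : ∀ x, t₀ x ≠ 0 → (s x).val < i := fun x hx => by
      by_contra hne
      exact hx (if_neg hne)
    have hs₁ : ∀ x, t₁ x ≠ 0 → (s x).val = i := fun x hx => by
      by_contra hne
      exact hx (if_neg hne)
    have hs₂ : ∀ x, t₂ x ≠ 0 → (s x).val > i := fun x hx => by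
      by_contra hne
      exact hx (if_neg hne)
    have hzero : ∀ (u : ι → ZMod 2) (j : ℕ),
        (∀ x, u x ≠ 0 → j < (s x).val ∨ (s x).val + w ≤ j) → columnForm h j u = 0 := by
      intro u j hu
      rw [columnForm_apply]
      refine Finset.sum_eq_zero fun x _ => ?_
      by_contra hne
      have h1 := hr x j (right_ne_zero_of_mul hne)
      have h2 := hu x (left_ne_zero_of_mul hne)
      dsimp only at h1
      omega
    -- Left of the window only `t₀` contributes, so it must vanish there by itself. To the right of
    -- the window the same holds for `t₂`, since rows starting at or before `i` end by column `i + w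
    -- - 1`.
    obtain ⟨gA, hgA, hgAv⟩ := exists_mem_elimSpace hr (j := i.val) (t := t₀) hs₀ (fun j hj => by
      have h1 := htc j (by omega)
      rw [hsum, map_add, map_add, hzero t₁ j (fun x hx => by have := hs₁ x hx; omega),
        hzero t₂ j (fun x hx => by have := hs₂ x hx; omega), add_zero, add_zero] at h1
      rw [h1]
      exact dif_neg (by dsimp only; omega))
    obtain ⟨gB, hgB, hgBv⟩ := exists_mem_elimSpace hr' (j := m - w - i.val) (t := t₂)
      (fun x hx => by have := hs₂ x hx; have := (s x).isLt; omega) (fun j hj => by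
      rw [hmir j (by omega)]
      have h1 := htc (m - 1 - j) (by omega)
      rw [hsum, map_add, map_add, hzero t₀ _ (fun x hx => by have := hs₀ x hx; omega),
        hzero t₁ _ (fun x hx => by have := hs₁ x hx; omega), zero_add, zero_add] at h1
      rw [h1]
      exact dif_neg (by dsimp only; omega))
    refine ⟨gA + t₁ + gB, Submodule.add_mem_sup (Submodule.add_mem_sup hgA
      (mem_startSpace.2 hs₁)) hgB, ?_⟩
    ext k
    have hk := k.isLt
    have hcol : columnForm h (i + k) t = d k := by
      rw [htc (i + k) (by omega)]
      unfold ribbonRow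
      rw [dif_pos (by dsimp only; omega)]
      congr 1
      ext
      simp
    have hB : columnForm h (i + k) gB = columnForm h (i + k) t₂ := by
      have h1 := hgBv (m - 1 - (i + k)) (by omega)
      rw [hmir _ (by omega), hmir _ (by omega)] at h1
      rwa [show m - 1 - (m - 1 - (i.val + k.val)) = i + k by omega] at h1
    show columnForm h (i + k) (gA + t₁ + gB) = d k
    rw [map_add, map_add, hB, hgAv _ (by omega), ← map_add, ← map_add, ← hsum, hcol]
  calc _ ≤ Module.finrank (ZMod 2) ((A ⊔ startSpace (fun x => (s x).val) i ⊔ B).map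
        (windowForm h w i)) := Submodule.finrank_mono key
    _ ≤ Module.finrank (ZMod 2) (A ⊔ startSpace (fun x => (s x).val) i ⊔ B :
        Submodule (ZMod 2) (ι → ZMod 2)) := Submodule.finrank_map_le _ _
    _ ≤ _ := (Submodule.finrank_add_le_finrank_add_finrank _ _).trans
      (Nat.add_le_add_right (finrank_elimSpace_sup_le w _ h i) _)

open Classical in
/-- The number of coefficient vectors for which the row at position `i` is in the row space,
summed over all coefficient vectors of the rows. -/
theorem sum_card_mem_span_le (hw : 1 ≤ w) (hwm : w ≤ m) (s : ι → Fin (m - w + 1))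
    (i : Fin (m - w + 1)) {a : ℝ} (ha1 : 1 ≤ a) (ha2 : a ≤ 2) :
    ∑ c : ι → Fin w → ZMod 2, ((Finset.univ.filter fun d : Fin w → ZMod 2 =>
      ribbonRow m w i d ∈ Submodule.span (ZMod 2)
        (Set.range fun x => ribbonRow m w (s x) (c x))).card : ℝ) ≤
      Fintype.card (ι → Fin w → ZMod 2) * 2 ^ w * ((a⁻¹) ^ w *
        a ^ (Finset.univ.filter fun x => (s x).val = i.val).card *
        (queueBound a (fun x => (s x).val) i *
          queueBound a (fun x => m - w - (s x).val) (m - w - i))) := by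
  have ha0 : 0 < a := by linarith
  have hpt : ∀ c : ι → Fin w → ZMod 2, ((Finset.univ.filter fun d : Fin w → ZMod 2 =>
      ribbonRow m w i d ∈ Submodule.span (ZMod 2)
        (Set.range fun x => ribbonRow m w (s x) (c x))).card : ℝ) ≤
      2 ^ w * (a⁻¹) ^ w * a ^ (Finset.univ.filter fun x => (s x).val = i.val).card *
      a ^ (Module.finrank (ZMod 2) (elimSpace w (fun x => (s x).val) (ribbonBits m w s c) i) +
        Module.finrank (ZMod 2) (elimSpace w (fun x => m - w - (s x).val)
          (mirrorBits m (ribbonBits m w s c)) (m - w - i))) := by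
    intro c
    set V := (Submodule.span (ZMod 2)
        (Set.range fun x => ribbonRow m w (s x) (c x))).comap (ribbonRowLinear m w i)
    have hcard : (Finset.univ.filter fun d : Fin w → ZMod 2 =>
        ribbonRow m w i d ∈ Submodule.span (ZMod 2)
          (Set.range fun x => ribbonRow m w (s x) (c x))).card =
        2 ^ Module.finrank (ZMod 2) V := by
      rw [← Fintype.card_subtype, ← Nat.card_eq_fintype_card]
      have := Module.natCard_eq_pow_finrank (K := ZMod 2) (V := V)
      rw [Nat.card_zmod] at this
      exact this
    have hV : Module.finrank (ZMod 2) V ≤ w := by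
      simpa using Submodule.finrank_le V
    obtain ⟨e, he⟩ := Nat.exists_eq_add_of_le hV
    -- With `e = w - dim V ≥ 0` the codimension, this is `2 ^ (-e) ≤ a ^ (-e)`.
    have h1 : (2 : ℝ) ^ Module.finrank (ZMod 2) V ≤
        2 ^ w * (a⁻¹) ^ w * a ^ Module.finrank (ZMod 2) V := by
      set q := Module.finrank (ZMod 2) V
      have h2 : a ^ e ≤ 2 ^ e := by gcongr
      have h3 : (a⁻¹) ^ w * a ^ w = 1 := by rw [← mul_pow, inv_mul_cancel₀ ha0.ne', one_pow]
      calc (2 : ℝ) ^ q = 2 ^ q * ((a⁻¹) ^ w * a ^ w) := by rw [h3, mul_one]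
        _ = 2 ^ q * (a⁻¹) ^ w * a ^ q * a ^ e := by
          nth_rewrite 2 [he]
          rw [pow_add]; ring
        _ ≤ 2 ^ q * (a⁻¹) ^ w * a ^ q * 2 ^ e := by gcongr
        _ = _ := by
          have : (2 : ℝ) ^ w = 2 ^ q * 2 ^ e := by rw [← pow_add, ← he]
          rw [this]; ring
    rw [hcard]
    push_cast
    refine h1.trans ?_
    rw [mul_assoc (2 ^ w * (a⁻¹) ^ w), ← pow_add]
    refine mul_le_mul_of_nonneg_left (pow_le_pow_right₀ ha1 ?_) (by positivity)
    have : Module.finrank (ZMod 2) V ≤ _ := finrank_comap_ribbonRowLinear_le hwm s c i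
    omega
  refine (Finset.sum_le_sum fun c _ => hpt c).trans ?_
  rw [← Finset.mul_sum]
  refine (mul_le_mul_of_nonneg_left (sum_pow_finrank_elimSpace_add_le hw hwm s i.val
    ha1 ha2) (by positivity)).trans (le_of_eq ?_)
  ring

end Window

/-! ### Analytic estimates: the binomial moment, the geometric sum and the constants. -/

section Estimates

/-- Centring the Bernoulli variable cancels the linear terms of `exp x ≤ 1 + x + x ^ 2`, leaving
only the variance `f * (1 - f)`. -/
theorem one_add_mul_exp_sub_one_le {f θ : ℝ} (hf0 : 0 ≤ f) (hf1 : f ≤ 1) (hθ0 : 0 ≤ θ)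
    (hθ1 : θ ≤ 1) : 1 + f * (Real.exp θ - 1) ≤ Real.exp (f * θ + f * (1 - f) * θ ^ 2) := by
  have hexp : ∀ x : ℝ, |x| ≤ 1 → Real.exp x ≤ 1 + x + x ^ 2 := fun x hx => by
    have := (abs_le.1 (Real.abs_exp_sub_one_sub_id_le hx)).2
    linarith
  have h1 := hexp (-(f * θ)) (by rw [abs_neg, abs_of_nonneg (by positivity)]; nlinarith)
  have h2 := hexp ((1 - f) * θ) (by
    rw [abs_of_nonneg (mul_nonneg (by linarith) hθ0)]; nlinarith)
  have h3 : (1 - f) * Real.exp (-(f * θ)) + f * Real.exp ((1 - f) * θ) ≤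
      1 + f * (1 - f) * θ ^ 2 := by
    have h4 := mul_le_mul_of_nonneg_left h1 (sub_nonneg.2 hf1)
    have h5 := mul_le_mul_of_nonneg_left h2 hf0
    refine (add_le_add h4 h5).trans (le_of_eq ?_)
    ring
  have h6 : 1 + f * (Real.exp θ - 1) = Real.exp (f * θ) *
      ((1 - f) * Real.exp (-(f * θ)) + f * Real.exp ((1 - f) * θ)) := by
    have e1 : Real.exp (f * θ) * Real.exp (-(f * θ)) = 1 := by rw [← Real.exp_add]; simp
    have e2 : Real.exp (f * θ) * Real.exp ((1 - f) * θ) = Real.exp θ := by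
      rw [← Real.exp_add]; congr 1; ring
    linear_combination (-(1 - f)) * e1 - f * e2
  rw [h6, Real.exp_add]
  refine mul_le_mul_of_nonneg_left (h3.trans ?_) (Real.exp_pos _).le
  have := Real.add_one_le_exp (f * (1 - f) * θ ^ 2)
  linarith

/-- The contribution of a window of `L` starting positions, out of `M = (1 + ε) n - w + 1`, to
the exponential moment with parameter `θ = (ε + w / n) / 4`. -/
theorem window_moment_le {n : ℕ} {w ε L M θ : ℝ} (hn : 1 ≤ n) (hw : 1 ≤ w) (hε0 : 0 ≤ ε)
    (hε1 : ε ≤ 1 / 2) (hwm : w ≤ (1 + ε) * n) (hM : M = (1 + ε) * n - w + 1) (hL0 : 0 ≤ L)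
    (hLM : L ≤ M) (hθ : θ = (ε + w / n) / 4) :
    (1 + L / M * (Real.exp θ - 1)) ^ n * Real.exp (-(θ * (w + L - 1))) ≤
      Real.exp (1 / 2 - 3 * (ε * w) / 32) * Real.exp (-(ε ^ 2 / 16 * L)) := by
  have hn0 : (1 : ℝ) ≤ n := by exact_mod_cast hn
  have hnpos : (0 : ℝ) < n := by linarith
  have hM0 : 0 < M := by linarith
  set f := L / M with hf
  have hf0 : 0 ≤ f := by positivity
  have hf1 : f ≤ 1 := (div_le_one hM0).2 hLM
  have hfL : L = f * M := by rw [hf]; field_simp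
  have hwn : w / n ≤ 3 / 2 := by
    rw [div_le_iff₀ hnpos]
    nlinarith
  have hwn0 : 0 ≤ w / n := by positivity
  have hθ0 : 0 ≤ θ := by rw [hθ]; positivity
  have hθ1 : θ ≤ 1 / 2 := by rw [hθ]; linarith
  have hnθ : n * θ = (ε * n + w) / 4 := by
    rw [hθ]; field_simp
  have h1 : (1 + f * (Real.exp θ - 1)) ^ n ≤ Real.exp (n * (f * θ + f * (1 - f) * θ ^ 2)) := by
    rw [Real.exp_nat_mul]
    refine pow_le_pow_left₀ ?_ (one_add_mul_exp_sub_one_le hf0 hf1 hθ0 (by linarith)) n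
    have := Real.one_le_exp hθ0
    nlinarith
  refine (mul_le_mul_of_nonneg_right h1 (Real.exp_pos _).le).trans ?_
  rw [← Real.exp_add, ← Real.exp_add]
  refine Real.exp_le_exp.2 ?_
  have hf1' : 0 ≤ 1 - f := by linarith
  -- Up to the term `1 - f`, `Y` is the mean slack: the length `w + L - 1` minus the expected number
  -- `n * f` of arrivals. The choice of `θ` makes the variance term cost at most a quarter of the
  -- gain `θ * Y`.
  set Y := f * (ε * n) + (1 - f) * w with hY
  have hvar : n * (f * (1 - f) * θ ^ 2) ≤ θ * (Y / 4) := by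
    have : n * (f * (1 - f) * θ ^ 2) = θ * (f * (1 - f) * (n * θ)) := by ring
    rw [this, hnθ]
    refine mul_le_mul_of_nonneg_left ?_ hθ0
    have e1 : f * (1 - f) * (ε * n) ≤ f * (ε * n) := by
      refine mul_le_mul_of_nonneg_right ?_ (by positivity)
      nlinarith
    have e2 : f * (1 - f) * w ≤ (1 - f) * w := by
      refine mul_le_mul_of_nonneg_right ?_ (by positivity)
      nlinarith
    rw [hY]
    linarith
  have h4 : 4 * (θ * Y) = f * ε ^ 2 * n + ε * w + (1 - f) * w * (w / n) := by
    rw [hθ, hY]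
    field_simp
    ring
  have h5 : 0 ≤ (1 - f) * w * (w / n) := by positivity
  have h6 : 0 ≤ f * ε ^ 2 * n := by positivity
  have h7 : 0 ≤ ε * w := by positivity
  have hMn : M ≤ 3 / 2 * n := by rw [hM]; nlinarith
  have h8 : ε ^ 2 / 16 * L ≤ 3 / 32 * (f * ε ^ 2 * n) := by
    rw [hfL]
    have := mul_le_mul_of_nonneg_left hMn (show 0 ≤ ε ^ 2 / 16 * f by positivity)
    linarith
  have h9 : θ * (1 - f) ≤ 1 / 2 := by nlinarith
  have h10 : n * (f * θ) - θ * (w + L - 1) = θ * (1 - f) - θ * Y := by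
    rw [hfL, hM, hY]; ring
  linarith

theorem sum_exp_neg_mul_le {α : ℝ} (hα0 : 0 < α) (hα1 : α ≤ 1 / 2) (K : ℕ) :
    ∑ k ∈ Finset.range K, Real.exp (-(α * k)) ≤ 2 / α := by
  have h1 : Real.exp (-α) ≤ 1 - α / 2 := by
    have := (abs_le.1 (Real.abs_exp_sub_one_sub_id_le (x := -α)
      (by rw [abs_neg, abs_of_pos hα0]; linarith))).2
    nlinarith
  have h0 := Real.exp_pos (-α)
  have h2 : ∑ k ∈ Finset.range K, Real.exp (-(α * k)) =
      ∑ k ∈ Finset.range K, Real.exp (-α) ^ k := by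
    refine Finset.sum_congr rfl fun k _ => ?_
    rw [← Real.exp_nat_mul]
    congr 1
    ring
  rw [h2, geom_sum_eq (by linarith), ← neg_div_neg_eq, neg_sub, neg_sub, div_le_div_iff₀
    (by linarith) hα0]
  have := pow_pos h0 K
  nlinarith

/-- The polynomial losses are absorbed when `ε` is large compared with `log w / w`. -/
theorem poly_mul_exp_le {w : ℕ} {ε : ℝ} (hw : 2 ≤ w) (hε : 240 * (Real.log w / w) ≤ ε) :
    0 < ε ∧ Real.exp (1 / 2 - 3 * (ε * w) / 32) * (2 / (ε ^ 2 / 16)) ^ 2 ≤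
      Real.exp (-(1 / 32 * (ε * w))) := by
  have hw2 : (2 : ℝ) ≤ w := by exact_mod_cast hw
  have hw0 : (0 : ℝ) < w := by linarith
  have hlog2 : 1 / 2 ≤ Real.log 2 := by have := Real.log_two_gt_d9; linarith
  have hlog : Real.log 2 ≤ Real.log w := Real.log_le_log (by norm_num) hw2
  have hεw : 240 * Real.log w ≤ ε * w := by
    rw [← mul_div_assoc, div_le_iff₀ hw0] at hε
    exact hε
  have hε0 : 0 < ε := by
    by_contra hne
    nlinarith
  refine ⟨hε0, ?_⟩
  have h1 : 1 ≤ ε * w := by linarith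
  have h2 : (2 / (ε ^ 2 / 16)) ^ 2 ≤ 2 ^ 10 * (w : ℝ) ^ 4 := by
    have : (2 / (ε ^ 2 / 16)) ^ 2 = 2 ^ 10 / ε ^ 4 := by field_simp; norm_num
    rw [this, div_le_iff₀ (by positivity)]
    have := one_le_pow₀ h1 (n := 4)
    rw [mul_pow] at this
    nlinarith
  -- The constant `240 = 16 * 15` comes from here: `ε w / 16 ≥ 15 log w` has to cover `14 log w` and
  -- the extra `1 / 2 ≤ log w`, where `1 / 16 = 3 / 32 - 1 / 32`.
  have h3 : (2 : ℝ) ^ 10 * (w : ℝ) ^ 4 ≤ w ^ 14 := by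
    rw [show (w : ℝ) ^ 14 = w ^ 10 * w ^ 4 by ring]
    gcongr
  have h4 : (w : ℝ) ^ 14 = Real.exp (14 * Real.log w) := by
    rw [← Real.exp_log hw0, ← Real.exp_nat_mul, Real.log_exp]
    norm_num
  refine (mul_le_mul_of_nonneg_left (h2.trans h3) (Real.exp_pos _).le).trans ?_
  rw [h4, ← Real.exp_add]
  refine Real.exp_le_exp.2 ?_
  linarith

end Estimates

/-! ### Averaging over the starting positions. -/

section StartingPositions

variable {ι : Type*} [Fintype ι] [DecidableEq ι]

/-- The weight is a product over the keys, so the sum over all position functions factorizes. -/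
theorem sum_pow_card_filter_mem {M : ℕ} (I : Finset (Fin M)) (a : ℝ) :
    ∑ s : ι → Fin M, a ^ (Finset.univ.filter fun x => s x ∈ I).card =
      (M + I.card * (a - 1)) ^ Fintype.card ι := by
  have h1 : ∀ s : ι → Fin M, a ^ (Finset.univ.filter fun x => s x ∈ I).card =
      ∏ x, if s x ∈ I then a else 1 := by
    intro s
    rw [← Finset.prod_filter, Finset.prod_const]
  have h2 : ∑ b : Fin M, (if b ∈ I then a else 1) = M + I.card * (a - 1) := by
    have : ∀ b : Fin M, (if b ∈ I then a else 1) = 1 + if b ∈ I then a - 1 else 0 := by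
      intro b; split_ifs <;> ring
    simp only [this, Finset.sum_add_distrib, ← Finset.sum_filter]
    simp [mul_sub]
  simp only [h1]
  rw [← h2, ← Finset.card_univ, ← Finset.prod_const, Finset.prod_univ_sum, Fintype.piFinset_univ]

/-- A left window `[i - k, i)`, the point `i` and a reflected right window `(i, i + l]` are disjoint
and fill `[i - k, i + l]`, so their counts add in the exponent. -/
theorem queueBound_mul_queueBound (s : ι → ℕ) {N i : ℕ} (hs : ∀ x, s x ≤ N) (hi : i ≤ N) (a : ℝ)
    (w : ℕ) :
    (a⁻¹) ^ w * a ^ (Finset.univ.filter fun x => s x = i).card *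
      (queueBound a s i * queueBound a (fun x => N - s x) (N - i)) =
    ∑ k ∈ Finset.range (i + 1), ∑ l ∈ Finset.range (N - i + 1), (a⁻¹) ^ (w + k + l) *
      a ^ (Finset.univ.filter fun x => i - k ≤ s x ∧ s x ≤ i + l).card := by
  unfold queueBound
  rw [Finset.sum_mul_sum, Finset.mul_sum]
  refine Finset.sum_congr rfl fun k hk => ?_
  rw [Finset.mul_sum]
  refine Finset.sum_congr rfl fun l hl => ?_
  have hk' : k ≤ i := by simpa [Nat.lt_succ_iff] using hk
  have hl' : l ≤ N - i := by simpa [Nat.lt_succ_iff] using hl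
  have hcard : (Finset.univ.filter fun x => i - k ≤ s x ∧ s x ≤ i + l).card =
      (Finset.univ.filter fun x => s x = i).card +
      ((Finset.univ.filter fun x => i - k ≤ s x ∧ s x < i).card +
        (Finset.univ.filter fun x => N - i - l ≤ N - s x ∧ N - s x < N - i).card) := by
    rw [← Finset.card_union_of_disjoint, ← Finset.card_union_of_disjoint]
    · congr 1
      ext x
      have := hs x
      simp only [Finset.mem_filter, Finset.mem_univ, true_and, Finset.mem_union]
      omega
    · rw [Finset.disjoint_left]
      intro x
      simp only [Finset.mem_filter, Finset.mem_univ, true_and, Finset.mem_union]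
      omega
    · rw [Finset.disjoint_left]
      intro x
      simp only [Finset.mem_filter, Finset.mem_univ, true_and]
      omega
  rw [hcard]
  simp only [pow_add]
  ring

theorem sum_queueBound_le {m w : ℕ} {ε : ℝ} (hι : 1 ≤ Fintype.card ι) (hw : 2 ≤ w) (hwm : w ≤ m)
    (hm : (m : ℝ) = (1 + ε) * Fintype.card ι) (hε : 240 * (Real.log w / w) ≤ ε)
    (hε1 : ε ≤ 1 / 2) {a : ℝ} (ha : a = Real.exp ((ε + w / Fintype.card ι) / 4))
    (i : Fin (m - w + 1)) :
    ∑ s : ι → Fin (m - w + 1), (a⁻¹) ^ w *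
        a ^ (Finset.univ.filter fun x => (s x).val = i.val).card *
        (queueBound a (fun x => (s x).val) i *
          queueBound a (fun x => m - w - (s x).val) (m - w - i)) ≤
      ((m - w + 1 : ℕ) : ℝ) ^ Fintype.card ι * Real.exp (-(1 / 32 * (ε * w))) := by
  obtain ⟨hε0, hfin⟩ := poly_mul_exp_le hw hε
  set n := Fintype.card ι with hn
  set θ := (ε + w / n) / 4 with hθ
  set M : ℝ := ((m - w + 1 : ℕ) : ℝ) with hM
  have hMe : M = (1 + ε) * n - w + 1 := by
    rw [hM, Nat.cast_add, Nat.cast_sub hwm, hm, Nat.cast_one]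
  have hM0 : 0 < M := by rw [hM]; positivity
  have hilt := i.isLt
  set α := ε ^ 2 / 16 with hα
  have hα0 : 0 < α := by positivity
  have hα1 : α ≤ 1 / 2 := by rw [hα]; nlinarith
  have hterm : ∀ k ∈ Finset.range (i.val + 1), ∀ l ∈ Finset.range (m - w - i + 1),
      ∑ s : ι → Fin (m - w + 1), (a⁻¹) ^ (w + k + l) *
        a ^ (Finset.univ.filter fun x => i.val - k ≤ (s x).val ∧ (s x).val ≤ i.val + l).card ≤
      M ^ n * Real.exp (1 / 2 - 3 * (ε * w) / 32) *
        (Real.exp (-(α * k)) * Real.exp (-(α * l))) := by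
    intro k hk l hl
    have hk' : k ≤ i := by simpa [Nat.lt_succ_iff] using hk
    have hl' : l ≤ m - w - i := by simpa [Nat.lt_succ_iff] using hl
    -- Here `L = k + l + 1`, so the exponent `w + k + l` of `a⁻¹` is the `w + L - 1` of
    -- `window_moment_le`.
    set I : Finset (Fin (m - w + 1)) := Finset.Icc ⟨i - k, by omega⟩ ⟨i + l, by omega⟩ with hI
    have hIcard : I.card = k + l + 1 := by
      rw [hI, Fin.card_Icc]
      dsimp only
      omega
    have hmem : ∀ s : ι → Fin (m - w + 1),
        (Finset.univ.filter fun x => i.val - k ≤ (s x).val ∧ (s x).val ≤ i.val + l) =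
        Finset.univ.filter fun x => s x ∈ I := by
      intro s
      ext x
      simp [hI, Finset.mem_Icc, Fin.le_def]
    simp only [hmem]
    rw [← Finset.mul_sum, sum_pow_card_filter_mem, hIcard, ← hn, ← hM]
    set L : ℝ := ((k + l + 1 : ℕ) : ℝ) with hL
    have hLM : L ≤ M := by
      rw [hL, hM]
      exact_mod_cast (by omega : k + l + 1 ≤ m - w + 1)
    have hmom := window_moment_le (n := n) (w := w) (ε := ε) (L := L) (M := M) (θ := θ) hι
      (by exact_mod_cast (by omega : 1 ≤ w)) hε0.le hε1 (by rw [← hm]; exact_mod_cast hwm) hMe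
      (by positivity) hLM hθ
    have e1 : (M + L * (a - 1)) ^ n = M ^ n * (1 + L / M * (Real.exp θ - 1)) ^ n := by
      rw [← mul_pow, ha]
      congr 1
      field_simp
    have e2 : (a⁻¹) ^ (w + k + l) = Real.exp (-(θ * (w + L - 1))) := by
      rw [ha, ← Real.exp_neg, ← Real.exp_nat_mul]
      congr 1
      rw [hL]
      push_cast
      ring
    rw [e1, e2, mul_left_comm, mul_comm (Real.exp (-(θ * (w + L - 1)))), mul_assoc]
    refine mul_le_mul_of_nonneg_left (hmom.trans ?_) (by positivity)
    refine mul_le_mul_of_nonneg_left ?_ (Real.exp_pos _).le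
    rw [← Real.exp_add]
    refine Real.exp_le_exp.2 ?_
    rw [hL, ← hα]
    push_cast
    linarith
  have hrew : ∀ s : ι → Fin (m - w + 1), _ := fun s => queueBound_mul_queueBound
    (fun x => (s x).val) (N := m - w) (i := i.val) (fun x => by have := (s x).isLt; omega)
    (by omega) a w
  simp only [hrew]
  rw [Finset.sum_comm]
  calc _ ≤ ∑ k ∈ Finset.range (i.val + 1), ∑ l ∈ Finset.range (m - w - i + 1),
        M ^ n * Real.exp (1 / 2 - 3 * (ε * w) / 32) *
        (Real.exp (-(α * k)) * Real.exp (-(α * l))) := by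
        refine Finset.sum_le_sum fun k hk => ?_
        rw [Finset.sum_comm]
        exact Finset.sum_le_sum fun l hl => hterm k hk l hl
    _ = M ^ n * Real.exp (1 / 2 - 3 * (ε * w) / 32) *
        ((∑ k ∈ Finset.range (i.val + 1), Real.exp (-(α * k))) *
          ∑ l ∈ Finset.range (m - w - i + 1), Real.exp (-(α * l))) := by
        rw [Finset.sum_mul_sum, Finset.mul_sum]
        exact Finset.sum_congr rfl fun k _ => by rw [Finset.mul_sum]
    _ ≤ M ^ n * Real.exp (1 / 2 - 3 * (ε * w) / 32) * ((2 / α) * (2 / α)) := by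
        refine mul_le_mul_of_nonneg_left ?_ (by positivity)
        exact mul_le_mul (sum_exp_neg_mul_le hα0 hα1 _) (sum_exp_neg_mul_le hα0 hα1 _)
          (Finset.sum_nonneg fun _ _ => (Real.exp_pos _).le) (by positivity)
    _ ≤ _ := by
        rw [mul_assoc, ← sq]
        exact mul_le_mul_of_nonneg_left hfin (by positivity)

open Classical in
/-- The number of configurations in which the additional row lies in the row space. -/
theorem card_mem_span_le {m w : ℕ} {ε : ℝ} (hι : 1 ≤ Fintype.card ι) (hw : 2 ≤ w) (hwm : w ≤ m)
    (hm : (m : ℝ) = (1 + ε) * Fintype.card ι) (hε : 240 * (Real.log w / w) ≤ ε)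
    (hε1 : ε ≤ 1 / 2) :
    (∑ s : ι → Fin (m - w + 1), ∑ c : ι → Fin w → ZMod 2, ∑ i : Fin (m - w + 1),
      ((Finset.univ.filter fun d : Fin w → ZMod 2 =>
        ribbonRow m w i d ∈ Submodule.span (ZMod 2)
          (Set.range fun x => ribbonRow m w (s x) (c x))).card : ℝ)) ≤
      ((m - w + 1 : ℕ) * 2 ^ w) ^ (Fintype.card ι + 1) * Real.exp (-(1 / 32 * (ε * w))) := by
  obtain ⟨hε0, -⟩ := poly_mul_exp_le hw hε
  set n := Fintype.card ι with hn
  have hn0 : (1 : ℝ) ≤ n := by exact_mod_cast hι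
  set a := Real.exp ((ε + w / n) / 4) with ha
  have hwn : (w : ℝ) / n ≤ 3 / 2 := by
    rw [div_le_iff₀ (by linarith)]
    have : (w : ℝ) ≤ m := by exact_mod_cast hwm
    nlinarith
  have ha1 : 1 ≤ a := Real.one_le_exp (by positivity)
  have ha2 : a ≤ 2 := by
    have h1 : a ≤ Real.exp (1 / 2) := Real.exp_le_exp.2 (by linarith)
    have h2 := (abs_le.1 (Real.abs_exp_sub_one_sub_id_le (x := 1 / 2)
      (by rw [abs_of_pos] <;> norm_num))).2
    linarith
  have hC : (Fintype.card (ι → Fin w → ZMod 2) : ℝ) = (2 ^ w) ^ n := by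
    simp [hn]
  have h1 : ∀ s : ι → Fin (m - w + 1), ∀ i : Fin (m - w + 1), _ := fun s i =>
    sum_card_mem_span_le (by omega : 1 ≤ w) hwm s i ha1 ha2
  have h2 : ∀ i : Fin (m - w + 1), _ := fun i => sum_queueBound_le hι hw hwm hm hε hε1 ha i
  calc _ = ∑ i : Fin (m - w + 1), ∑ s : ι → Fin (m - w + 1), ∑ c : ι → Fin w → ZMod 2,
      ((Finset.univ.filter fun d : Fin w → ZMod 2 =>
        ribbonRow m w i d ∈ Submodule.span (ZMod 2)
          (Set.range fun x => ribbonRow m w (s x) (c x))).card : ℝ) := by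
        refine Eq.trans (Finset.sum_congr rfl fun s _ => ?_) Finset.sum_comm
        exact Finset.sum_comm
    _ ≤ ∑ i : Fin (m - w + 1), ∑ s : ι → Fin (m - w + 1),
        Fintype.card (ι → Fin w → ZMod 2) * 2 ^ w * ((a⁻¹) ^ w *
          a ^ (Finset.univ.filter fun x => (s x).val = i.val).card *
          (queueBound a (fun x => (s x).val) i *
            queueBound a (fun x => m - w - (s x).val) (m - w - i))) :=
        Finset.sum_le_sum fun i _ => Finset.sum_le_sum fun s _ => h1 s i
    _ ≤ ∑ i : Fin (m - w + 1), (2 ^ w) ^ n * 2 ^ w * (((m - w + 1 : ℕ) : ℝ) ^ n *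
          Real.exp (-(1 / 32 * (ε * w)))) := by
        refine Finset.sum_le_sum fun i _ => ?_
        rw [← Finset.mul_sum, hC]
        exact mul_le_mul_of_nonneg_left (h2 i) (by positivity)
    _ = _ := by
        rw [Finset.sum_const, Finset.card_univ, Fintype.card_fin, nsmul_eq_mul]
        ring

end StartingPositions

/-! ### From counting configurations to probabilities, and width one. -/

section Probability

variable {U Ω : Type*} [MeasurableSpace Ω] {P : Measure Ω} [IsProbabilityMeasure P] {m w : ℕ}
  {s : U → Ω → Fin (m - w + 1)} {c : U → Ω → (Fin w → ZMod 2)}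

/-- Finitely many distinct keys have jointly uniform hash values. -/
theorem IsRandomRibbonHash.measureReal_preimage (h : IsRandomRibbonHash P m w s c)
    {κ : Type*} [Fintype κ] [DecidableEq κ] {e : κ → U} (he : Function.Injective e)
    (A : Finset (κ → Fin (m - w + 1) × (Fin w → ZMod 2))) :
    P.real {ω | (fun o => (s (e o) ω, c (e o) ω)) ∈ A} =
      A.card * (((m - w + 1 : ℕ) * 2 ^ w : ℝ)⁻¹) ^ Fintype.card κ := by
  set f : κ → Ω → Fin (m - w + 1) × (Fin w → ZMod 2) := fun o ω => (s (e o) ω, c (e o) ω) with hf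
  have hmeas : ∀ o, Measurable (f o) := fun o => h.measurable (e o)
  have hind : iIndepFun f P := h.indep.precomp he
  have hmap := (iIndepFun_iff_map_fun_eq_pi_map fun o => (hmeas o).aemeasurable).1 hind
  have hF : Measurable fun ω o => f o ω := measurable_pi_lambda _ hmeas
  have hsingle : ∀ b : Fin (m - w + 1) × (Fin w → ZMod 2),
      (uniformOn (Set.univ : Set (Fin (m - w + 1) × (Fin w → ZMod 2)))) {b} =
        ((Fintype.card (Fin (m - w + 1) × (Fin w → ZMod 2)) : ℕ) : ENNReal)⁻¹ := by
    intro b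
    rw [uniformOn_univ, Measure.count_singleton, one_div]
  have hpt : ∀ b : κ → Fin (m - w + 1) × (Fin w → ZMod 2),
      (P.map fun ω o => f o ω).real {b} =
        (((m - w + 1 : ℕ) * 2 ^ w : ℝ)⁻¹) ^ Fintype.card κ := by
    intro b
    have : ∀ o, IsProbabilityMeasure (P.map (f o)) := fun o =>
      Measure.isProbabilityMeasure_map (hmeas o).aemeasurable
    rw [hmap, Measure.real, Measure.pi_singleton]
    have : ∀ o, P.map (f o) {b o} =
        ((Fintype.card (Fin (m - w + 1) × (Fin w → ZMod 2)) : ℕ) : ENNReal)⁻¹ := fun o => by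
      rw [← hsingle (b o), ← h.uniform (e o)]
    simp only [this]
    rw [Finset.prod_const, ENNReal.toReal_pow, ENNReal.toReal_inv, ENNReal.toReal_natCast,
      Finset.card_univ]
    simp
  have : IsProbabilityMeasure (P.map fun ω o => f o ω) :=
    Measure.isProbabilityMeasure_map hF.aemeasurable
  have h1 : P.real {ω | (fun o => f o ω) ∈ A} = (P.map fun ω o => f o ω).real (A : Set _) := by
    rw [map_measureReal_apply hF A.finite_toSet.measurableSet]
    rfl
  rw [h1, ← sum_measureReal_singleton]
  simp [hpt]

-- Indexing by `Option S`, with `none` for the query, makes the `S.card + 1` hash values jointly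
-- uniform; `y ∉ S` is what makes this indexing injective.
open Classical in
theorem spanProb_eq (h : IsRandomRibbonHash P m w s c) (S : Finset U) {y : U} (hy : y ∉ S) :
    spanProb P m w s c S y =
      (∑ σ : S → Fin (m - w + 1), ∑ γ : S → Fin w → ZMod 2, ∑ i : Fin (m - w + 1),
      ((Finset.univ.filter fun d : Fin w → ZMod 2 =>
        ribbonRow m w i d ∈ Submodule.span (ZMod 2)
          (Set.range fun x => ribbonRow m w (σ x) (γ x))).card : ℝ)) *
        (((m - w + 1 : ℕ) * 2 ^ w : ℝ)⁻¹) ^ (S.card + 1) := by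
  set e : Option S → U := fun o => o.elim y Subtype.val with he
  have hinj : Function.Injective e := by
    rintro (_ | a) (_ | b) hab
    · rfl
    · exact absurd (show y = b from hab) fun hyb => hy (hyb ▸ b.2)
    · exact absurd (show (a : U) = y from hab) fun hya => hy (hya ▸ a.2)
    · exact congrArg some (Subtype.ext hab)
  set A : Finset (Option S → Fin (m - w + 1) × (Fin w → ZMod 2)) :=
    Finset.univ.filter fun b => ribbonRow m w (b none).1 (b none).2 ∈ Submodule.span (ZMod 2)
      (Set.range fun x : S => ribbonRow m w (b (some x)).1 (b (some x)).2) with hA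
  have h1 : spanProb P m w s c S y = P.real {ω | (fun o => (s (e o) ω, c (e o) ω)) ∈ A} := by
    unfold spanProb
    congr 1
    ext ω
    simp only [hA, Set.mem_ofPred_eq, Finset.mem_filter, Finset.mem_univ, true_and]
    rw [Set.image_eq_range]
    rfl
  rw [h1, h.measureReal_preimage hinj, Fintype.card_option, Fintype.card_coe]
  congr 1
  have h2 : (A.card : ℝ) = ∑ b : Option S → Fin (m - w + 1) × (Fin w → ZMod 2),
      if ribbonRow m w (b none).1 (b none).2 ∈ Submodule.span (ZMod 2)
        (Set.range fun x : S => ribbonRow m w (b (some x)).1 (b (some x)).2) then (1 : ℝ) else 0 := by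
    rw [hA, Finset.card_filter]
    push_cast
    rfl
  rw [h2]
  let E : (Option S → Fin (m - w + 1) × (Fin w → ZMod 2)) ≃
      ((S → Fin (m - w + 1)) × (S → Fin w → ZMod 2)) × (Fin (m - w + 1) × (Fin w → ZMod 2)) :=
    (Equiv.piOptionEquivProd.trans (Equiv.prodComm _ _)).trans
      (Equiv.prodCongr (Equiv.arrowProdEquivProdArrow _ _ _) (Equiv.refl _))
  refine Eq.trans (Fintype.sum_equiv E _ (fun q => if ribbonRow m w q.2.1 q.2.2 ∈ Submodule.span (ZMod 2)
        (Set.range fun x : S => ribbonRow m w (q.1.1 x) (q.1.2 x)) then (1 : ℝ) else 0)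
        fun b => rfl) ?_
  simp only [Fintype.sum_prod_type, Finset.card_filter, Nat.cast_sum, Nat.cast_ite, Nat.cast_one,
    Nat.cast_zero]

/-- For width one the span condition fails with constant probability. -/
theorem spanProb_width_one_le {s : U → Ω → Fin (m - 1 + 1)} {c : U → Ω → (Fin 1 → ZMod 2)}
    (h : IsRandomRibbonHash P m 1 s c) (S : Finset U) {y : U} (hy : y ∉ S) (hm : 1 ≤ m)
    (hS : S.card ≤ m) : spanProb P m 1 s c S y ≤ 3 / 4 := by
  classical
  -- At width one each row is zero or a unit vector, so a nonzero query row needs a key with the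
  -- same nonzero row. The first event has probability `1 / 2`, and each key adds `1 / (4 * m)`.
  have hcover : {ω | ribbonRow m 1 (s y ω) (c y ω) ∈
      Submodule.span (ZMod 2) ((fun x => ribbonRow m 1 (s x ω) (c x ω)) '' (S : Set U))} ⊆
      {ω | c y ω = 0} ∪ ⋃ x ∈ S, {ω | c y ω = 1 ∧ c x ω = 1 ∧ s y ω = s x ω} := by
    intro ω hω
    by_contra hne
    simp only [Set.mem_union, Set.mem_iUnion, Set.mem_ofPred_eq, not_or, not_exists, not_and] at hne
    obtain ⟨hcy, hx⟩ := hne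
    have hbit : ∀ d : Fin 1 → ZMod 2, d ≠ 0 → d = 1 := by decide
    have hcy1 := hbit _ hcy
    have hlt : (s y ω).val < m := by have := (s y ω).isLt; omega
    have hle : Submodule.span (ZMod 2)
        ((fun x => ribbonRow m 1 (s x ω) (c x ω)) '' (S : Set U)) ≤
        LinearMap.ker (LinearMap.proj (R := ZMod 2) (φ := fun _ : Fin m => ZMod 2)
          ⟨(s y ω).val, hlt⟩) := by
      rw [Submodule.span_le]
      rintro _ ⟨x, hxS, rfl⟩
      show ribbonRow m 1 (s x ω) (c x ω) ⟨(s y ω).val, hlt⟩ = 0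
      unfold ribbonRow
      split_ifs with hcond
      · have hs : s y ω = s x ω := Fin.ext (by dsimp only at hcond; omega)
        have hcx : c x ω = 0 := by
          by_contra hcx
          exact hx x hxS hcy1 (hbit _ hcx) hs
        simp [hcx]
      · rfl
    have h0 : ribbonRow m 1 (s y ω) (c y ω) ⟨(s y ω).val, hlt⟩ = 0 := hle hω
    unfold ribbonRow at h0
    rw [dif_pos (by dsimp only; omega), hcy1] at h0
    exact one_ne_zero h0
  have hmR : (1 : ℝ) ≤ m := by exact_mod_cast hm
  have hM : ((m - 1 + 1 : ℕ) : ℝ) = m := by rw [Nat.sub_add_cancel hm]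
  have hA : P.real {ω | c y ω = 0} = 1 / 2 := by
    have := h.measureReal_preimage (κ := Unit) (e := fun _ => y) (fun _ _ _ => rfl)
      (Finset.univ.image fun i : Fin (m - 1 + 1) => fun _ : Unit => (i, (0 : Fin 1 → ZMod 2)))
    rw [Finset.card_image_of_injective _ fun i j hij => congrArg Prod.fst (congrFun hij ()),
      Finset.card_univ, Fintype.card_fin, hM, Fintype.card_unit] at this
    convert this using 1
    · congr 1
      ext ω
      simp only [Set.mem_ofPred_eq, Finset.mem_image, Finset.mem_univ, true_and]
      constructor
      · intro hω
        exact ⟨s y ω, by rw [hω]⟩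
      · rintro ⟨i, hi⟩
        exact (congrArg Prod.snd (congrFun hi ())).symm
    · field_simp
  have hB : ∀ x ∈ S, P.real {ω | c y ω = 1 ∧ c x ω = 1 ∧ s y ω = s x ω} = 1 / (4 * m) := by
    intro x hx
    have hinj : Function.Injective fun b : Bool => if b then x else y := by
      have hne : x ≠ y := fun hxy => hy (hxy ▸ hx)
      rintro (_ | _) (_ | _) hab
      · rfl
      · exact absurd hab.symm hne
      · exact absurd hab hne
      · rfl
    have := h.measureReal_preimage (κ := Bool) hinj
      (Finset.univ.image fun i : Fin (m - 1 + 1) => fun _ : Bool => (i, (1 : Fin 1 → ZMod 2)))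
    rw [Finset.card_image_of_injective _ fun i j hij => congrArg Prod.fst (congrFun hij true),
      Finset.card_univ, Fintype.card_fin, hM, Fintype.card_bool] at this
    convert this using 1
    · congr 1
      ext ω
      simp only [Set.mem_ofPred_eq, Finset.mem_image, Finset.mem_univ, true_and]
      constructor
      · rintro ⟨h1, h2, h3⟩
        refine ⟨s y ω, funext fun b => ?_⟩
        cases b
        · simp [h1]
        · simp [h2, h3]
      · rintro ⟨i, hi⟩
        have hf := congrFun hi false
        have ht := congrFun hi true
        simp only [Bool.false_eq_true, if_false, if_true, Prod.mk.injEq] at hf ht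
        exact ⟨hf.2.symm, ht.2.symm, hf.1.symm.trans ht.1⟩
    · field_simp
      norm_num
  unfold spanProb
  calc _ ≤ P.real ({ω | c y ω = 0} ∪ ⋃ x ∈ S, {ω | c y ω = 1 ∧ c x ω = 1 ∧ s y ω = s x ω}) :=
        measureReal_mono hcover
    _ ≤ P.real {ω | c y ω = 0} + ∑ x ∈ S, P.real {ω | c y ω = 1 ∧ c x ω = 1 ∧ s y ω = s x ω} :=
        (measureReal_union_le _ _).trans
          (add_le_add_right (measureReal_biUnion_finset_le _ _) _)
    _ = 1 / 2 + S.card * (1 / (4 * m)) := by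
        rw [hA, Finset.sum_congr rfl hB, Finset.sum_const, nsmul_eq_mul]
    _ ≤ 3 / 4 := by
        have : (S.card : ℝ) ≤ m := by exact_mod_cast hS
        have : S.card * (1 / (4 * m) : ℝ) ≤ 1 / 4 := by
          rw [mul_one_div, div_le_div_iff₀ (by positivity) (by norm_num)]
          linarith
        linarith

end Probability

theorem mainTheorem2 :
    ∃ C : ℝ, 0 < C ∧ ∃ κ : ℝ, 0 < κ ∧
      ∀ (w n m : ℕ) (ε : ℝ), 1 ≤ w → 1 ≤ n → w ≤ m → ε = ((m : ℝ) - n) / n →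
        C * (Real.log w / w) ≤ ε → ε ≤ 1 / 2 →
        ∀ (U : Type*) (Ω : Type*) [MeasurableSpace Ω] (P : Measure Ω) [IsProbabilityMeasure P]
          (s : U → Ω → Fin (m - w + 1)) (c : U → Ω → (Fin w → ZMod 2)),
          IsRandomRibbonHash P m w s c →
          ∀ (S : Finset U) (y : U), S.card = n → y ∉ S →
            spanProb P m w s c S y ≤ Real.exp (-(κ * (ε * w))) := by
  refine ⟨240, by norm_num, 1 / 32, by norm_num, ?_⟩
  intro w n m ε hw hn hwm hεdef hε hε1 U Ω _ P _ s c h S y hS hy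
  classical
  have hn0 : (1 : ℝ) ≤ n := by exact_mod_cast hn
  have hm : (m : ℝ) = (1 + ε) * n := by
    rw [hεdef]
    field_simp
    ring
  -- For `w = 1` the hypothesis gives only `0 ≤ ε`, hence `n ≤ m`; the bound `3 / 4` suffices
  -- because `exp (-ε / 32) ≥ 1 - 1 / 64`.
  rcases hw.eq_or_lt with rfl | hw2
  · have hε0 : 0 ≤ ε := by simpa using hε
    have hnm : n ≤ m := by
      have : (n : ℝ) ≤ m := by rw [hm]; nlinarith
      exact_mod_cast this
    refine (spanProb_width_one_le h S hy hwm (hS.trans_le hnm)).trans ?_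
    have := Real.add_one_le_exp (-(1 / 32 * (ε * (1 : ℕ))))
    push_cast at this ⊢
    linarith
  · have hcard : Fintype.card S = n := by rw [Fintype.card_coe, hS]
    have := card_mem_span_le (ι := S) (by rw [hcard]; exact hn) hw2 hwm (by rw [hcard]; exact hm)
      hε hε1
    rw [spanProb_eq h S hy, inv_pow, ← div_eq_mul_inv, div_le_iff₀ (by positivity), mul_comm]
    rwa [Fintype.card_coe] at this
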